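/- **Conventions.** Let $(Z,\mathfrak Z,T)$ be a probability space and $\mathfrak D,\mathfrak E\subset\mathfrak Z$ sub-$\sigma$-algebras. A (lower) density $\delta:\mathfrak D\to\mathfrak E$ is a map with $\delta(\emptyset)=\emptyset$, $\delta(Z)=Z$, $\delta(A\cap B)=\delta(A)\cap\delta(B)$, $T(\delta(A)\triangle A)=0$, and $\delta(A)=\delta(B)$ whenever $T(A\triangle B)=0$. A measure $T$ is inner regular with respect to $\mathfrak D$ if for all $A\in\mathfrak Z$ and $\varepsilon>0$ there is $D\in\mathfrak D$ with $D\subset A$ and $T(A\setminus D)<\varepsilon$. For $F\subset X\times Y$ and $y\in Y$ put $F^y=\{x:(x,y)\in F\}$; $\widehat T$ denotes the completion of $T$. *Admissible densities.* Let $\{M_\alpha:\alpha<\kappa\}$ ($\kappa\ge1$ an ordinal) be subsets of $Z$ with $M_0=\emptyset$ and $\mathfrak Z=\sigma\{M_\alpha:\alpha<\kappa\}$, and for $1\le\gamma\le\kappa$ let $\mathfrak Z_\gamma=\sigma(\{M_\alpha:\alpha<\gamma\}\cup\{N\in\mathfrak Z:T(N)=0\})$. For each limit ordinal $\gamma\le\kappa$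 of countable cofinality fix a strictly increasing sequence $(\gamma_n)_{n}$ of ordinals $1\le\gamma_n<\gamma$ cofinal with $\gamma$. A density $\tau:\mathfrak Z\to\mathfrak Z$ is *admissible* (along $\{M_\alpha\}$ with these cofinal sequences) if $\tau=\tau_\kappa$ for maps $\tau_\gamma$ on $\mathfrak Z_\gamma$ ($1\le\gamma\le\kappa$) such that: (1) for $B\in\mathfrak Z_1$, $\tau_1(B)=\emptyset$ if $T(B)=0$ and $\tau_1(B)=Z$ otherwise; (2) if $\gamma$ is a limit ordinal of uncountable cofinality, then $\tau_\gamma(B)=\tau_\alpha(B)$ for $B\in\mathfrak Z_\alpha$, $1\le\alpha<\gamma$; (3) if $\gamma$ is a limit ordinal of countable cofinality, then $\tau_\gamma(B)=\bigcap_{k}\bigcup_{n}\bigcap_{m\ge n}\tau_{\gamma_m}(\{\mathbb E_{\mathfrak Z_{\gamma_m}}(\chi_B)>1-2^{-k}\})$ for $B\in\mathfrak Z_\gamma$; (4) if $\gamma=\beta+1$ with $\beta\ge1$, then for some $\mathfrak Z_\beta$-envelopes $F_1\supset M_\beta$ and $F_2\supset M_\beta^c$ (that is, $F_i\in\mathfrak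 Z_\beta$ and $T(F_i\setminus F')=0$ for every $F'\in\mathfrak Z_\beta$ containing the set enveloped by $F_i$) and all $G,H\in\mathfrak Z_\beta$, $$\tau_\gamma\big((G\cap M_\beta)\cup(H\cap M_\beta^c)\big)=\big[M_\beta\cap\tau_\beta\big((G\cap F_1)\cup(H\cap F_1^c)\big)\big]\cup\big[M_\beta^c\cap\tau_\beta\big((H\cap F_2)\cup(G\cap F_2^c)\big)\big].$$ **Proposition.** Let $(X,\mathfrak A,P)$ and $(Y,\mathfrak B,Q)$ be probability spaces and let $R$ be a probability measure on $\mathfrak A\otimes\mathfrak B$ with marginals $P$ and $Q$. Let $\mathbb S=\{(\mathfrak A_y,S_y):y\in Y\}$ be a disintegration of $R$ with respect to $Q$: each $\mathfrak A_y\subset\mathfrak A$ is a $\sigma$-algebra and $S_y$ a probability measure on $\mathfrak A_y$; for each $A\in\mathfrak A$ there is $N\in\mathfrak B$ with $Q(N)=0$ such that $A\in\mathfrak A_y$ for all $y\notin N$ and $y\mapsto S_y(A)$ is $\mathfrak B$-measurable on $Y\setminus N$; and $\int_B S_y(A)\,dQ(y)=R(A\times B)$ for all $A\in\mathfrak A$,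 $B\in\mathfrak B$. Let $\mathfrak C\subset\bigcap_{y\in Y}\mathfrak A_y$ be a $\sigma$-algebra such that $P$ and each $S_y$ are inner regular with respect to $\mathfrak C$. Let $\{\tau_y:y\in Y\}$ be an equi-admissible family of densities determined by a transfinite sequence $\{M_\alpha:\alpha<\kappa\}$ with $M_0=\emptyset$ generating $\mathfrak C$; that is, each $\tau_y$ is an admissible density on $(X,\mathfrak C,S_y|_{\mathfrak C})$ along $\{M_\alpha:\alpha<\kappa\}$, with the same cofinal sequences for all $y$. Each $\tau_y$ is extended to the completion $\widehat{\mathfrak A_y}$ by $\tau_y(E)=\tau_y(C)$ whenever $C\in\mathfrak C$ and $\widehat{S_y}(E\triangle C)=0$. Let $\mathcal M$ be the family of all $E\subset X\times Y$ for which there is $N\in\mathfrak B$ with $Q(N)=0$ and $\widehat{S_y}(E^y)=0$ for all $y\notin N$, and let $\mathcal N$ be the family of all $E\in\mathcal M$ such that $E^y\in\mathfrak A_y$ for every $y\in Y$. Put $$\mathfrak A\ltimes\mathfrak B=\{W\triangle N:W\in\mathfrak A\otimes\mathfrak B,\ N\in\mathcal M\},\qquad \mathfrak C\ltimes_{\mathbb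 S}\mathfrak B=\{W\triangle N:W\in\mathfrak C\otimes\mathfrak B,\ N\in\mathcal N\},$$ and let $\widehat{R_\ltimes}$ be the measure on $\mathfrak A\ltimes\mathfrak B$ given by $\widehat{R_\ltimes}(V)=\int_Y\widehat{S_y}(V^y)\,d\widehat Q(y)$, equivalently by $\widehat{R_\ltimes}(W\triangle N)=R(W)$ for $W\in\mathfrak A\otimes\mathfrak B$, $N\in\mathcal M$. Then there exists a density $\varphi:\mathfrak A\ltimes\mathfrak B\to\mathfrak C\ltimes_{\mathbb S}\mathfrak B$ with respect to $\widehat{R_\ltimes}$ such that for each $F\in\mathfrak A\ltimes\mathfrak B$ $$[\varphi(F)]^y=\tau_y\big([\varphi(F)]^y\big)\qquad\text{for all } y\in Y.$$ -/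

import Mathlib

open MeasureTheory Set
open scoped ENNReal symmDiff Cardinal

universe u v w

/-! ### Lower densities -/

/-- `δ : D → E` is a lower density with respect to the measure `T`. Only the values of `δ` on sets
of the σ-algebra `D` matter; these values belong to the σ-algebra `E`. -/
structure IsLowerDensity {Z : Type*} {mZ : MeasurableSpace Z} (T : Measure Z)
    (D E : MeasurableSpace Z) (δ : Set Z → Set Z) : Prop where
  measurable : ∀ B, MeasurableSet[D] B → MeasurableSet[E] (δ B)
  empty : δ ∅ = ∅
  univ : δ Set.univ = Set.univ
  inter : ∀ B C, MeasurableSet[D] B → MeasurableSet[D] C → δ (B ∩ C) = δ B ∩ δ C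
  equiv : ∀ B, MeasurableSet[D] B → T (δ B ∆ B) = 0
  congr : ∀ B C, MeasurableSet[D] B → MeasurableSet[D] C → T (B ∆ C) = 0 → δ B = δ C

/-- The canonical extension of a density `τ` on `mC` to the sets `E` that agree with some
`C ∈ mC` up to a null set of (the completion of) `μ`: the value at `E` is `τ C`
(all such `τ C` coincide when `τ` is a density). -/
def densityExtension {X : Type*} {m : MeasurableSpace X} (μ : Measure X)
    (mC : MeasurableSpace X) (τ : Set X → Set X) (E : Set X) : Set X :=
  {x | ∃ C, MeasurableSet[mC] C ∧ μ (E ∆ C) = 0 ∧ x ∈ τ C}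

/-- `μ` is inner regular with respect to (approximated by) the family `D`. -/
def ApproximatedBy {X : Type*} {m : MeasurableSpace X} (μ : Measure X)
    (D : Set (Set X)) : Prop :=
  ∀ E, MeasurableSet E → ∀ ε : ℝ≥0∞, 0 < ε → ∃ K ∈ D, K ⊆ E ∧ μ (E \ K) < ε

/-! ### Admissible densities -/

/-- `F` is a `D`-envelope (a `D`-measurable hull) of `M` with respect to `T`. -/
structure IsEnvelope {Z : Type*} {mZ : MeasurableSpace Z} (T : Measure Z)
    (D : MeasurableSpace Z) (M F : Set Z) : Prop where
  measurable : MeasurableSet[D] F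
  subset : M ⊆ F
  minimal : ∀ F', MeasurableSet[D] F' → M ⊆ F' → T (F \ F') = 0

/-- The σ-algebra `σ({M_α : α < γ} ∪ {T-null sets})`. -/
@[reducible] def stageAlgebra {Z : Type*} {mZ : MeasurableSpace Z} (T : Measure Z)
    (M : Ordinal.{w} → Set Z) (γ : Ordinal.{w}) : MeasurableSpace Z :=
  MeasurableSpace.generateFrom
    ({E | ∃ α < γ, E = M α} ∪ {E | MeasurableSet[mZ] E ∧ T E = 0})

/-- An increasing sequence of ordinals `1 ≤ s n < γ` cofinal with `γ`. -/
structure IsCofinalSequence (γ : Ordinal.{w}) (s : ℕ → Ordinal.{w}) : Prop where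
  strictMono : StrictMono s
  one_le : ∀ n, 1 ≤ s n
  lt : ∀ n, s n < γ
  cofinal : ∀ α < γ, ∃ n, α ≤ s n

/-- `s` assigns a cofinal sequence to each limit ordinal `γ ≤ κ` of countable cofinality. -/
def IsCofinalSystem (κ : Ordinal.{w}) (s : Ordinal.{w} → ℕ → Ordinal.{w}) : Prop :=
  ∀ γ ≤ κ, Order.IsSuccLimit γ → γ.cof = ℵ₀ → IsCofinalSequence γ (s γ)

/-- The family `M_α`, `α < κ`, is a transfinite sequence with `M_0 = ∅` generating the
σ-algebra `mC`. -/
structure IsGeneratingSequence {Z : Type*} (mC : MeasurableSpace Z) (κ : Ordinal.{w})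
    (M : Ordinal.{w} → Set Z) : Prop where
  pos : 0 < κ
  zero : M 0 = ∅
  generate : mC = MeasurableSpace.generateFrom {E | ∃ α < κ, E = M α}

/-- The recursion which produces the densities `t γ`, `1 ≤ γ ≤ κ`, on the σ-algebras
`stageAlgebra T M γ`. The values of `t γ` on other sets, and `t 0`, play no role. -/
structure IsAdmissibleConstruction {Z : Type*} {mZ : MeasurableSpace Z} (T : Measure Z)
    (κ : Ordinal.{w}) (M : Ordinal.{w} → Set Z) (s : Ordinal.{w} → ℕ → Ordinal.{w})
    (t : Ordinal.{w} → Set Z → Set Z) : Prop where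
  one_null : ∀ B, MeasurableSet[stageAlgebra T M 1] B → T B = 0 → t 1 B = ∅
  one_pos : ∀ B, MeasurableSet[stageAlgebra T M 1] B → T B ≠ 0 → t 1 B = Set.univ
  uncountable : ∀ γ ≤ κ, Order.IsSuccLimit γ → ℵ₀ < γ.cof →
    ∀ α, 1 ≤ α → α < γ → ∀ B, MeasurableSet[stageAlgebra T M α] B → t γ B = t α B
  countable : ∀ γ ≤ κ, Order.IsSuccLimit γ → γ.cof = ℵ₀ →
    ∀ B, MeasurableSet[stageAlgebra T M γ] B →
      t γ B = ⋂ k : ℕ, ⋃ n : ℕ, ⋂ m : ℕ, ⋂ _ : n ≤ m,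
        t (s γ m) {z | (T[B.indicator (fun _ => (1 : ℝ)) | stageAlgebra T M (s γ m)]) z
          > 1 - (2 : ℝ)⁻¹ ^ k}
  succ : ∀ β, 1 ≤ β → β + 1 ≤ κ → ∃ F₁ F₂ : Set Z,
    IsEnvelope T (stageAlgebra T M β) (M β) F₁ ∧
    IsEnvelope T (stageAlgebra T M β) (M β)ᶜ F₂ ∧
    ∀ G H, MeasurableSet[stageAlgebra T M β] G → MeasurableSet[stageAlgebra T M β] H →
      t (β + 1) ((G ∩ M β) ∪ (H ∩ (M β)ᶜ)) =
        (M β ∩ t β ((G ∩ F₁) ∪ (H ∩ F₁ᶜ))) ∪ ((M β)ᶜ ∩ t β ((H ∩ F₂) ∪ (G ∩ F₂ᶜ)))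

/-- `τ` is an admissible density on the measure space `(Z, mZ, T)`, constructed along the
transfinite generating sequence `M_α`, `α < κ`, with the cofinal sequences `s`. -/
structure IsAdmissibleDensity {Z : Type*} {mZ : MeasurableSpace Z} (T : Measure Z)
    (κ : Ordinal.{w}) (M : Ordinal.{w} → Set Z) (s : Ordinal.{w} → ℕ → Ordinal.{w})
    (τ : Set Z → Set Z) : Prop where
  density : IsLowerDensity T mZ mZ τ
  generating : IsGeneratingSequence mZ κ M
  cofinal : IsCofinalSystem κ s
  construction : ∃ t : Ordinal.{w} → Set Z → Set Z, IsAdmissibleConstruction T κ M s t ∧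
    ∀ B, MeasurableSet[mZ] B → τ B = t κ B

/-- `(τ_y)` is an equi-admissible family of densities on `mC`, determined by `M_α`, `α < κ`: each
`τ y` is an admissible density for `S_y` restricted to `mC`, all of them along the same
transfinite sequence and with the same cofinal sequences. -/
def IsEquiAdmissible {X : Type*} {Y : Type*} (mC : MeasurableSpace X)
    (A : Y → MeasurableSpace X) (S : ∀ y, Measure[A y] X) (hC : ∀ y, mC ≤ A y)
    (κ : Ordinal.{w}) (M : Ordinal.{w} → Set X) (τ : Y → Set X → Set X) : Prop :=
  ∃ s : Ordinal.{w} → ℕ → Ordinal.{w},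
    ∀ y, IsAdmissibleDensity (mZ := mC) ((S y).trim (hC y)) κ M s (τ y)

/-! ### Skew products and disintegrations -/

/-- The section `F^y = {x | (x, y) ∈ F}`. -/
def ySection {X : Type*} {Y : Type*} (F : Set (X × Y)) (y : Y) : Set X := {x | (x, y) ∈ F}

/-- `R` is a skew product of `P` and `Q`: a measure on `𝔄 ⊗ 𝔅` with marginals `P` and `Q`. -/
structure IsSkewProduct {X : Type*} {Y : Type*} [MeasurableSpace X] [MeasurableSpace Y]
    (P : Measure X) (Q : Measure Y) (R : Measure (X × Y)) : Prop where
  fst : R.map Prod.fst = P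
  snd : R.map Prod.snd = Q

/-- `(A_y, S_y)` is a `Q`-disintegration of `R`. -/
structure IsDisintegration {X : Type*} {Y : Type*} [mX : MeasurableSpace X] [MeasurableSpace Y]
    (Q : Measure Y) (R : Measure (X × Y))
    (A : Y → MeasurableSpace X) (S : ∀ y, Measure[A y] X) : Prop where
  le : ∀ y, A y ≤ mX
  prob : ∀ y, IsProbabilityMeasure (S y)
  dis1 : ∀ E, MeasurableSet[mX] E → ∃ N, MeasurableSet N ∧ Q N = 0 ∧
    (∀ y ∉ N, MeasurableSet[A y] E) ∧ Measurable (fun y : ↥(Nᶜ) => S y E)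
  dis2 : ∀ E B, MeasurableSet[mX] E → MeasurableSet B → ∫⁻ y in B, S y E ∂Q = R (E ×ˢ B)

section NilSets

variable {X : Type*} {Y : Type*}

/-- `E` is a nil set: outside a `Q`-null set of `y`, the section `E^y` is null for the completion
of `S_y` (a measure applied to an arbitrary set is the induced outer measure). -/
def IsNil [mY : MeasurableSpace Y] (Q : Measure Y) (A : Y → MeasurableSpace X) (S : ∀ y, Measure[A y] X)
    (E : Set (X × Y)) : Prop :=
  ∀ᵐ y ∂Q, S y (ySection E y) = 0

/-- The sets `E` all of whose sections are in `A_y`, and `S_y`-null outside a `Q`-null set. -/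
def IsStrictNil [mY : MeasurableSpace Y] (Q : Measure Y) (A : Y → MeasurableSpace X) (S : ∀ y, Measure[A y] X)
    (E : Set (X × Y)) : Prop :=
  (∀ y, MeasurableSet[A y] (ySection E y)) ∧ ∀ᵐ y ∂Q, S y (ySection E y) = 0

theorem ySection_iUnion (f : ℕ → Set (X × Y)) (y : Y) :
    ySection (⋃ i, f i) y = ⋃ i, ySection (f i) y := by
  ext x; simp [ySection]

theorem symmDiff_iUnion_subset {Z : Type*} (f g : ℕ → Set Z) :
    (⋃ i, f i) ∆ (⋃ i, g i) ⊆ ⋃ i, f i ∆ g i := by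
  intro z hz
  simp only [Set.mem_symmDiff, mem_iUnion] at hz ⊢
  rcases hz with ⟨⟨i, hi⟩, h⟩ | ⟨⟨i, hi⟩, h⟩
  · exact ⟨i, Or.inl ⟨hi, fun h' => h ⟨i, h'⟩⟩⟩
  · exact ⟨i, Or.inr ⟨hi, fun h' => h ⟨i, h'⟩⟩⟩

theorem IsNil.iUnion [mY : MeasurableSpace Y] {Q : Measure Y} {A : Y → MeasurableSpace X} {S : ∀ y, Measure[A y] X}
    {f : ℕ → Set (X × Y)} (h : ∀ i, IsNil Q A S (f i)) : IsNil Q A S (⋃ i, f i) := by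
  filter_upwards [ae_all_iff.2 h] with y hy
  rw [ySection_iUnion]
  exact measure_iUnion_null hy

theorem IsNil.mono [mY : MeasurableSpace Y] {Q : Measure Y} {A : Y → MeasurableSpace X} {S : ∀ y, Measure[A y] X}
    {E F : Set (X × Y)} (h : IsNil Q A S F) (hEF : E ⊆ F) : IsNil Q A S E := by
  filter_upwards [h] with y hy
  exact measure_mono_null (fun x hx => hEF hx) hy

/-- The σ-algebra `𝔄 ⋉ 𝔅` of all sets `W ∆ N` with `W ∈ 𝔄 ⊗ 𝔅` and `N` nil. -/
@[reducible] def skewAlgebra [mX : MeasurableSpace X] [mY : MeasurableSpace Y]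
    (Q : Measure Y) (A : Y → MeasurableSpace X) (S : ∀ y, Measure[A y] X) :
    MeasurableSpace (X × Y) where
  MeasurableSet' V := ∃ W N, MeasurableSet W ∧ IsNil Q A S N ∧ V = W ∆ N
  measurableSet_empty :=
    ⟨∅, ∅, MeasurableSet.empty, Filter.Eventually.of_forall fun y => by simp [ySection], by simp⟩
  measurableSet_compl := by
    rintro V ⟨W, N, hW, hN, rfl⟩
    refine ⟨Wᶜ, N, hW.compl, hN, ?_⟩
    ext z; simp only [Set.mem_symmDiff, mem_compl_iff]; tauto
  measurableSet_iUnion := by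
    intro f hf
    choose W N hW hN hfWN using hf
    refine ⟨⋃ i, W i, (⋃ i, W i) ∆ (⋃ i, f i), MeasurableSet.iUnion hW, ?_,
      (symmDiff_symmDiff_cancel_left _ _).symm⟩
    refine (IsNil.iUnion hN).mono ((symmDiff_iUnion_subset _ _).trans ?_)
    refine iUnion_mono fun i => ?_
    rw [hfWN i, symmDiff_symmDiff_cancel_left]

/-- The σ-algebra `mC ⋉_S 𝔅` of all sets `W ∆ N` with `W ∈ mC ⊗ 𝔅` and `N` strictly nil, where
`mC ⊆ A_y` for all `y`. -/
@[reducible] def strictSkewAlgebra [mY : MeasurableSpace Y]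
    (mC : MeasurableSpace X) (Q : Measure Y) (A : Y → MeasurableSpace X)
    (S : ∀ y, Measure[A y] X) (hC : ∀ y, mC ≤ A y) : MeasurableSpace (X × Y) where
  MeasurableSet' V := ∃ W N, MeasurableSet[mC.prod mY] W ∧ IsStrictNil Q A S N ∧ V = W ∆ N
  measurableSet_empty :=
    ⟨∅, ∅, MeasurableSet.empty, ⟨fun y => by simp [ySection],
      Filter.Eventually.of_forall fun y => by simp [ySection]⟩, by simp⟩
  measurableSet_compl := by
    rintro V ⟨W, N, hW, hN, rfl⟩
    refine ⟨Wᶜ, N, hW.compl, hN, ?_⟩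
    ext z; simp only [Set.mem_symmDiff, mem_compl_iff]; tauto
  measurableSet_iUnion := by
    intro f hf
    choose W N hW hN hfWN using hf
    have hsec : ∀ i y, MeasurableSet[A y] (ySection (W i) y) := fun i y =>
      hC y _ ((@measurable_prodMk_right X Y mC mY y) (hW i))
    have hsecf : ∀ i y, MeasurableSet[A y] (ySection (f i) y) := fun i y => by
      rw [hfWN i]
      exact (hsec i y).symmDiff ((hN i).1 y)
    refine ⟨⋃ i, W i, (⋃ i, W i) ∆ (⋃ i, f i), MeasurableSet.iUnion hW, ⟨fun y => ?_, ?_⟩,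
      (symmDiff_symmDiff_cancel_left _ _).symm⟩
    · change MeasurableSet[A y] (ySection (⋃ i, W i) y ∆ ySection (⋃ i, f i) y)
      rw [ySection_iUnion, ySection_iUnion]
      exact (MeasurableSet.iUnion fun i => hsec i y).symmDiff
        (MeasurableSet.iUnion fun i => hsecf i y)
    · refine (IsNil.iUnion (Q := Q) (A := A) (S := S) (f := N) fun i => (hN i).2).mono ((symmDiff_iUnion_subset _ _).trans ?_)
      refine iUnion_mono fun i => ?_
      rw [hfWN i, symmDiff_symmDiff_cancel_left]

/-- Sections of sets of `𝔄 ⊗ 𝔅` under a disintegration. -/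
theorem IsDisintegration.section_prod [mX : MeasurableSpace X] [mY : MeasurableSpace Y]
    {Q : Measure Y} [IsProbabilityMeasure Q]
    {R : Measure (X × Y)} {A : Y → MeasurableSpace X} {S : ∀ y, Measure[A y] X}
    (h : IsDisintegration Q R A S) {W : Set (X × Y)} (hW : MeasurableSet W) :
    (∀ᵐ y ∂Q, MeasurableSet[A y] (ySection W y)) ∧
      AEMeasurable (fun y => S y (ySection W y)) Q ∧ ∫⁻ y, S y (ySection W y) ∂Q = R W := by
  have hprob := h.prob
  have hR : R Set.univ = 1 := by
    have := h.dis2 Set.univ Set.univ MeasurableSet.univ MeasurableSet.univ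
    simpa using this.symm
  have hRf : IsFiniteMeasure R := ⟨by simp [hR]⟩
  have hae : ∀ E, MeasurableSet[mX] E → (∀ᵐ y ∂Q, MeasurableSet[A y] E) ∧
      AEMeasurable (fun y => S y E) Q := by
    intro E hE
    obtain ⟨N, hN, hQN, hm, hmeas⟩ := h.dis1 E hE
    have hNc : ∀ᵐ y ∂Q, y ∈ Nᶜ := by
      rw [ae_iff]; simpa using hQN
    refine ⟨hNc.mono hm, ?_⟩
    have := aemeasurable_restrict_of_measurable_subtype (μ := Q) (f := fun y => S y E)
      hN.compl hmeas
    rwa [Measure.restrict_eq_self_of_ae_mem hNc] at this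
  induction W, hW using MeasurableSpace.induction_on_inter generateFrom_prod.symm
    isPiSystem_prod with
  | empty =>
    have : ∀ y : Y, ySection (∅ : Set (X × Y)) y = ∅ := fun y => rfl
    simp [this]
  | basic W hW =>
    classical
    obtain ⟨E, hE, B, hB, rfl⟩ := hW
    have hs : ∀ y, ySection (E ×ˢ B) y = if y ∈ B then E else ∅ := by
      intro y; ext x; by_cases hy : y ∈ B <;> simp [ySection, hy]
    have hs' : (fun y => S y (ySection (E ×ˢ B) y)) = B.indicator (fun y => S y E) := by
      ext y; by_cases hy : y ∈ B <;> simp [hs, hy]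
    refine ⟨?_, ?_, ?_⟩
    · filter_upwards [(hae E hE).1] with y hy
      rw [hs]; split_ifs
      · exact hy
      · exact @MeasurableSet.empty X (A y)
    · rw [hs']; exact (hae E hE).2.indicator hB
    · rw [hs', lintegral_indicator hB, h.dis2 E B hE hB]
  | compl W hW ih =>
    obtain ⟨h1, h2, h3⟩ := ih
    have hc : (fun y => S y (ySection Wᶜ y)) =ᵐ[Q] fun y => 1 - S y (ySection W y) := by
      filter_upwards [h1] with y hy
      have : ySection Wᶜ y = (ySection W y)ᶜ := rfl
      rw [this, prob_compl_eq_one_sub hy]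
    refine ⟨h1.mono fun y hy => hy.compl, ?_, ?_⟩
    · exact (aemeasurable_const.sub h2).congr hc.symm
    · rw [lintegral_congr_ae hc, lintegral_sub' h2 (by rw [h3]; exact measure_ne_top R W)
        (Filter.Eventually.of_forall fun y => prob_le_one), h3, measure_compl hW
        (measure_ne_top R W), hR]
      simp
  | iUnion f hd hm ih =>
    have h1 := ae_all_iff.2 fun i => (ih i).1
    have hu : (fun y => S y (ySection (⋃ i, f i) y)) =ᵐ[Q]
        fun y => ∑' i, S y (ySection (f i) y) := by
      filter_upwards [h1] with y hy
      rw [ySection_iUnion]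
      exact measure_iUnion (fun i j hij => (hd hij).preimage fun x => (x, y)) hy
    refine ⟨?_, ?_, ?_⟩
    · filter_upwards [h1] with y hy
      rw [ySection_iUnion]
      exact MeasurableSet.iUnion hy
    · exact (AEMeasurable.tsum fun i => (ih i).2.1).congr hu.symm
    · rw [lintegral_congr_ae hu, lintegral_tsum fun i => (ih i).2.1, measure_iUnion hd hm]
      exact tsum_congr fun i => (ih i).2.2

/-- Modifying a set by a nil set changes almost no section by more than a null set. -/
theorem ySection_symmDiff_ae [mY : MeasurableSpace Y] {Q : Measure Y} {A : Y → MeasurableSpace X}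
    {S : ∀ y, Measure[A y] X} {N : Set (X × Y)} (hN : IsNil Q A S N) (W : Set (X × Y)) :
    ∀ᵐ y ∂Q, ySection (W ∆ N) y =ᵐ[S y] ySection W y := by
  filter_upwards [hN] with y hy
  rw [← measure_symmDiff_eq_zero_iff]
  have : ySection (W ∆ N) y ∆ ySection W y = ySection N y := by
    change (ySection W y ∆ ySection N y) ∆ ySection W y = ySection N y
    rw [symmDiff_comm, symmDiff_symmDiff_cancel_left]
  rw [this]; exact hy

/-- Sections of sets of `𝔄 ⋉ 𝔅` under a disintegration. -/
theorem IsDisintegration.section_skew [mX : MeasurableSpace X] [mY : MeasurableSpace Y]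
    {Q : Measure Y} [IsProbabilityMeasure Q]
    {R : Measure (X × Y)} {A : Y → MeasurableSpace X} {S : ∀ y, Measure[A y] X}
    (h : IsDisintegration Q R A S) {V : Set (X × Y)}
    (hV : MeasurableSet[skewAlgebra Q A S] V) :
    (∀ᵐ y ∂Q, @NullMeasurableSet X (A y) (ySection V y) (S y)) ∧
      AEMeasurable (fun y => S y (ySection V y)) Q := by
  obtain ⟨W, N, hW, hN, rfl⟩ := hV
  obtain ⟨h1, h2, -⟩ := h.section_prod hW
  have h3 := ySection_symmDiff_ae hN W
  refine ⟨?_, h2.congr ?_⟩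
  · filter_upwards [h1, h3] with y hy hy'
    exact hy.nullMeasurableSet.congr hy'.symm
  · filter_upwards [h3] with y hy
    exact (measure_congr hy).symm

/-- The extension of `R` to `𝔄 ⋉ 𝔅`, given by `V ↦ ∫ S_y(V^y) dQ(y)`. -/
noncomputable def skewMeasure [mX : MeasurableSpace X] [mY : MeasurableSpace Y]
    {Q : Measure Y} [IsProbabilityMeasure Q]
    {R : Measure (X × Y)} {A : Y → MeasurableSpace X} {S : ∀ y, Measure[A y] X}
    (h : IsDisintegration Q R A S) : Measure[skewAlgebra Q A S] (X × Y) :=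
  @Measure.ofMeasurable (X × Y) (skewAlgebra Q A S) (fun V _ => ∫⁻ y, S y (ySection V y) ∂Q)
    (by
      have : ∀ y : Y, ySection (∅ : Set (X × Y)) y = ∅ := fun y => rfl
      simp [this])
    (by
      intro f hf hd
      have h1 := ae_all_iff.2 fun i => (h.section_skew (hf i)).1
      have hu : (fun y => S y (ySection (⋃ i, f i) y)) =ᵐ[Q]
          fun y => ∑' i, S y (ySection (f i) y) := by
        filter_upwards [h1] with y hy
        rw [ySection_iUnion]
        exact measure_iUnion₀
          (fun i j hij => ((hd hij).preimage fun x => (x, y)).aedisjoint) hy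
      change ∫⁻ y, S y (ySection (⋃ i, f i) y) ∂Q = ∑' i, ∫⁻ y, S y (ySection (f i) y) ∂Q
      rw [lintegral_congr_ae hu, lintegral_tsum fun i => (h.section_skew (hf i)).2])

/-- The extension satisfies `W ∆ N ↦ R W` for `W ∈ 𝔄 ⊗ 𝔅` and nil `N`. -/
theorem skewMeasure_symmDiff [mX : MeasurableSpace X] [mY : MeasurableSpace Y]
    {Q : Measure Y} [IsProbabilityMeasure Q]
    {R : Measure (X × Y)} {A : Y → MeasurableSpace X} {S : ∀ y, Measure[A y] X}
    (h : IsDisintegration Q R A S) {W N : Set (X × Y)} (hW : MeasurableSet W)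
    (hN : IsNil Q A S N) : skewMeasure h (W ∆ N) = R W := by
  have hV : MeasurableSet[skewAlgebra Q A S] (W ∆ N) := ⟨W, N, hW, hN, rfl⟩
  rw [skewMeasure, @Measure.ofMeasurable_apply _ (skewAlgebra Q A S) _ _ _ _ hV, ← (h.section_prod hW).2.2]
  refine lintegral_congr_ae ?_
  filter_upwards [ySection_symmDiff_ae hN W] with y hy
  exact measure_congr hy

end NilSets

/-! ### Lower densities on arbitrary probability spaces -/

section LowerDensity

variable {Z : Type*} {D E mZ : MeasurableSpace Z} {T : Measure Z}
  {δ : Set Z → Set Z}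

/-! Write `C`, `B` for the σ-algebras `mC`, `mY`. The density `φ` comes from a density on the
product, followed by the given densities on the sections. Modulo nil sets, every `F` in the skew
algebra has a representative `v F` in `C ⊗ B` (`IsDisintegration.exists_isNil_symmDiff`). Let `δ` be
a lower density on `C ⊗ B` for the restriction of `R`, and let the section of `φ F` at `y` be `τ y`
of the section of `δ (v F)`.

The role of `δ` is to turn relations modulo nil sets into exact ones. Representatives respect
intersections only up to nil sets, hence sectionwise only for almost every `y`, whereas after `δ`
the identities hold as equalities of sets, so on every section. Applying `τ y` preserves them and
makes the section a fixed point, since `τ y E` and `E` differ by a null set. Joint measurability of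
`(y, E) ↦ τ y E` never enters: each section of `φ F` lies in `C` and `φ F ∆ v F` is nil, which is
exactly what the strict skew algebra asks for.

For this, the values of `δ` must lie in `C ⊗ B` itself and not in its completion, so that all their
sections are in `C`. Hence the density theorem is needed on a possibly incomplete probability space
(`exists_isLowerDensity`). It follows from Zorn's lemma for densities defined on sub-σ-algebras but
with values in the full σ-algebra. Such a density extends to one more set by measurable hulls
(`IsLowerDensity.exists_adjoinSet`), along a sequence by martingale convergence
(`exists_isLowerDensity_iSup`), and along chains in which countable subfamilies are bounded by
taking unions. -/

theorem IsLowerDensity.ae_mem_iff (h : IsLowerDensity T D E δ) {B : Set Z}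
    (hB : MeasurableSet[D] B) : ∀ᵐ z ∂T, z ∈ δ B ↔ z ∈ B :=
  Filter.eventuallyEq_set.1 (measure_symmDiff_eq_zero_iff.1 (h.equiv B hB))

theorem IsLowerDensity.eq_of_ae (h : IsLowerDensity T D E δ) {B C : Set Z}
    (hB : MeasurableSet[D] B) (hC : MeasurableSet[D] C) (hBC : ∀ᵐ z ∂T, z ∈ B ↔ z ∈ C) :
    δ B = δ C :=
  h.congr B C hB hC (measure_symmDiff_eq_zero_iff.2 (Filter.eventuallyEq_set.2 hBC))

theorem IsLowerDensity.subset_of_ae (h : IsLowerDensity T D E δ) {B C : Set Z}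
    (hB : MeasurableSet[D] B) (hC : MeasurableSet[D] C) (hBC : ∀ᵐ z ∂T, z ∈ B → z ∈ C) :
    δ B ⊆ δ C := by
  have : δ (B ∩ C) = δ B := h.eq_of_ae (hB.inter hC) hB (by
    filter_upwards [hBC] with z hz
    exact ⟨fun h => h.1, fun h => ⟨h, hz h⟩⟩)
  rw [← this, h.inter B C hB hC]
  exact inter_subset_right

/-! ### Extending a density by one set -/

/-- A measurable hull of `M` in the sub-σ-algebra `D`, up to null sets. -/
theorem exists_measurableSet_ae_hull [IsProbabilityMeasure T] (hD : D ≤ mZ) {M : Set Z}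
    (hM : MeasurableSet M) : ∃ F, MeasurableSet[D] F ∧ (∀ᵐ z ∂T, z ∈ M → z ∈ F) ∧
      ∀ G, MeasurableSet[D] G → (∀ᵐ z ∂T, z ∈ G → z ∉ M) → ∀ᵐ z ∂T, z ∈ G → z ∉ F := by
  -- The hull is the set where the conditional probability of `M` given `D` is positive. Off it, the
  -- indicator of `M` integrates to zero; on a `D`-set almost disjoint from `M`, the conditional
  -- probability vanishes almost everywhere.
  set g : Z → ℝ := M.indicator fun _ => (1 : ℝ) with hg
  have hgi : Integrable g T := (integrable_const _).indicator hM
  have hf : StronglyMeasurable[D] (T[g | D]) := stronglyMeasurable_condExp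
  have hg0 : ∀ z, 0 ≤ g z := fun z => indicator_nonneg (fun _ _ => zero_le_one) z
  have hf0 : 0 ≤ᵐ[T] T[g | D] := condExp_nonneg (Filter.Eventually.of_forall hg0)
  have hF : MeasurableSet[D] {z | 0 < (T[g | D]) z} :=
    hf.measurable measurableSet_Ioi
  refine ⟨{z | 0 < (T[g | D]) z}, hF, ?_, ?_⟩
  · have hF' := hF.compl
    have h1 := setIntegral_condExp hD hgi hF'
    have h2 : ∫ z in {z | 0 < (T[g | D]) z}ᶜ, (T[g | D]) z ∂T ≤ 0 :=
      setIntegral_nonpos (hD _ hF') fun z hz => not_lt.1 hz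
    have h3 : ∫ z in {z | 0 < (T[g | D]) z}ᶜ, g z ∂T = 0 :=
      le_antisymm (h1 ▸ h2) (setIntegral_nonneg (hD _ hF') fun z _ => hg0 z)
    rw [setIntegral_eq_zero_iff_of_nonneg_ae (Filter.Eventually.of_forall hg0)
      hgi.integrableOn] at h3
    filter_upwards [(ae_restrict_iff' (hD _ hF')).1 h3] with z hz hzM
    by_contra hzF
    have := hz hzF
    simp [hg, hzM] at this
  · intro G hG hGM
    have h1 := setIntegral_condExp hD hgi hG
    have h2 : ∫ z in G, g z ∂T = 0 := by
      refine setIntegral_eq_zero_of_ae_eq_zero ?_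
      filter_upwards [hGM] with z hz hzG
      exact indicator_of_notMem (hz hzG) _
    rw [h2, setIntegral_eq_zero_iff_of_nonneg_ae (ae_restrict_of_ae hf0)
      integrable_condExp.integrableOn] at h1
    filter_upwards [(ae_restrict_iff' (hD _ hG)).1 h1] with z hz hzG hzF
    exact (ne_of_gt hzF) (hz hzG)

theorem mem_ite_of_mem {M G H : Set Z} {z : Z} (hz : z ∈ M) : z ∈ M.ite G H ↔ z ∈ G := by
  simp [Set.ite, hz]

theorem mem_ite_of_notMem {M G H : Set Z} {z : Z} (hz : z ∉ M) : z ∈ M.ite G H ↔ z ∈ H := by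
  simp [Set.ite, hz]

/-- The σ-algebra generated by `D` and a set `M`. -/
@[reducible] def adjoinSet (D : MeasurableSpace Z) (M : Set Z) : MeasurableSpace Z where
  MeasurableSet' B := ∃ G H, MeasurableSet[D] G ∧ MeasurableSet[D] H ∧ B = M.ite G H
  measurableSet_empty := ⟨∅, ∅, MeasurableSet.empty, MeasurableSet.empty, by simp⟩
  measurableSet_compl := by
    rintro B ⟨G, H, hG, hH, rfl⟩
    refine ⟨Gᶜ, Hᶜ, hG.compl, hH.compl, ?_⟩
    ext z; by_cases hz : z ∈ M <;> simp [Set.ite, hz]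
  measurableSet_iUnion := by
    intro f hf
    choose G H hG hH hf using hf
    refine ⟨⋃ i, G i, ⋃ i, H i, MeasurableSet.iUnion hG, MeasurableSet.iUnion hH, ?_⟩
    ext z; by_cases hz : z ∈ M <;> simp [Set.ite, hz, hf]

/-- A lower density on `D` extends to the σ-algebra generated by `D` and a measurable set. -/
theorem IsLowerDensity.exists_adjoinSet [IsProbabilityMeasure T] (h : IsLowerDensity T D mZ δ)
    (hD : D ≤ mZ) {M : Set Z} (hM : MeasurableSet M) :
    ∃ δ', IsLowerDensity T (adjoinSet D M) mZ δ' ∧ ∀ B, MeasurableSet[D] B → δ' B = δ B := by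
  classical
  obtain ⟨F₁, hF₁, hMF₁, hmin₁⟩ := exists_measurableSet_ae_hull (T := T) hD hM
  obtain ⟨F₂, hF₂, hMF₂, hmin₂⟩ := exists_measurableSet_ae_hull (T := T) hD hM.compl
  -- The pair `(G, H)` is not unique: `G` is determined almost everywhere only on `F₁`, the hull of
  -- `M`. Outside `F₁` almost no point lies in `M`, and there `H` is determined, so `H` replaces
  -- `G`; symmetrically for `F₂`. With `G = H = B` both mixtures equal `B`, which is why the
  -- extension agrees with `δ`.
  let v : Set Z → Set Z → Set Z := fun G H => M.ite (δ (F₁.ite G H)) (δ (F₂.ite H G))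
  have hite : ∀ {F G H : Set Z}, MeasurableSet[D] F → MeasurableSet[D] G → MeasurableSet[D] H →
      MeasurableSet[D] (F.ite G H) := fun hF hG hH => hF.ite hG hH
  have key : ∀ {G H G' H' : Set Z}, MeasurableSet[D] G → MeasurableSet[D] H →
      MeasurableSet[D] G' → MeasurableSet[D] H' →
      (∀ᵐ z ∂T, z ∈ M.ite G H ↔ z ∈ M.ite G' H') → v G H = v G' H' := by
    intro G H G' H' hG hH hG' hH' hae
    have e₁ : ∀ᵐ z ∂T, z ∈ G ∆ G' → z ∉ M := by
      filter_upwards [hae] with z hz hzG hzM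
      rw [mem_ite_of_mem hzM, mem_ite_of_mem hzM] at hz
      rw [mem_symmDiff] at hzG
      tauto
    have e₂ : ∀ᵐ z ∂T, z ∈ H ∆ H' → z ∉ Mᶜ := by
      filter_upwards [hae] with z hz hzG hzM
      rw [mem_ite_of_notMem hzM, mem_ite_of_notMem hzM] at hz
      rw [mem_symmDiff] at hzG
      tauto
    have i₁ := hmin₁ _ (hG.symmDiff hG') e₁
    have i₂ := hmin₂ _ (hH.symmDiff hH') e₂
    have c₁ : δ (F₁.ite G H) = δ (F₁.ite G' H') := by
      refine h.eq_of_ae (hite hF₁ hG hH) (hite hF₁ hG' hH') ?_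
      filter_upwards [i₁, e₂, hMF₁] with z h1 h2 h3
      simp only [mem_symmDiff, mem_compl_iff, not_not] at h1 h2
      simp only [Set.ite, mem_union, mem_inter_iff, mem_sdiff]
      tauto
    have c₂ : δ (F₂.ite H G) = δ (F₂.ite H' G') := by
      refine h.eq_of_ae (hite hF₂ hH hG) (hite hF₂ hH' hG') ?_
      filter_upwards [i₂, e₁, hMF₂] with z h1 h2 h3
      simp only [mem_symmDiff, mem_compl_iff] at h1 h2 h3
      simp only [Set.ite, mem_union, mem_inter_iff, mem_sdiff]
      tauto
    simp only [v, c₁, c₂]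
  -- Choice of one representing pair; by `key` its value does not depend on the pair.
  let δ' : Set Z → Set Z := fun B =>
    if hB : MeasurableSet[adjoinSet D M] B then v hB.choose hB.choose_spec.choose else ∅
  have hδ' : ∀ {G H}, MeasurableSet[D] G → MeasurableSet[D] H → δ' (M.ite G H) = v G H := by
    intro G H hG hH
    have hB : MeasurableSet[adjoinSet D M] (M.ite G H) := ⟨G, H, hG, hH, rfl⟩
    obtain ⟨h1, h2, h3⟩ := hB.choose_spec.choose_spec
    have : δ' (M.ite G H) = v hB.choose hB.choose_spec.choose := dif_pos hB
    rw [this]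
    refine key h1 h2 hG hH (Filter.Eventually.of_forall fun z => ?_)
    rw [← h3]
  have hext : ∀ B, MeasurableSet[D] B → δ' B = δ B := by
    intro B hB
    have := hδ' hB hB
    simpa only [v, Set.ite_same] using this
  refine ⟨δ', ⟨?_, ?_, ?_, ?_, ?_, ?_⟩, hext⟩
  · rintro B ⟨G, H, hG, hH, rfl⟩
    rw [hδ' hG hH]
    exact hM.ite (h.measurable _ (hite hF₁ hG hH)) (h.measurable _ (hite hF₂ hH hG))
  · rw [hext _ (@MeasurableSet.empty Z D), h.empty]
  · rw [hext _ (@MeasurableSet.univ Z D), h.univ]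
  · rintro B C ⟨G, H, hG, hH, rfl⟩ ⟨G', H', hG', hH', rfl⟩
    rw [← ite_inter_inter, hδ' (hG.inter hG') (hH.inter hH'), hδ' hG hH, hδ' hG' hH']
    simp only [v]
    rw [ite_inter_inter, ite_inter_inter, h.inter _ _ (hite hF₁ hG hH) (hite hF₁ hG' hH'),
      h.inter _ _ (hite hF₂ hH hG) (hite hF₂ hH' hG'), ite_inter_inter]
  · rintro B ⟨G, H, hG, hH, rfl⟩
    rw [hδ' hG hH, measure_symmDiff_eq_zero_iff, Filter.eventuallyEq_set]
    filter_upwards [h.ae_mem_iff (hite hF₁ hG hH), h.ae_mem_iff (hite hF₂ hH hG), hMF₁, hMF₂]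
      with z h1 h2 h3 h4
    by_cases hz : z ∈ M
    · simp only [v, mem_ite_of_mem hz, h1, mem_ite_of_mem (h3 hz)]
    · simp only [v, mem_ite_of_notMem hz, h2, mem_ite_of_mem (h4 hz)]
  · rintro B C ⟨G, H, hG, hH, rfl⟩ ⟨G', H', hG', hH', rfl⟩ hBC
    rw [hδ' hG hH, hδ' hG' hH']
    exact key hG hH hG' hH' (Filter.eventuallyEq_set.1 (measure_symmDiff_eq_zero_iff.1 hBC))

/-! ### Martingale limit of densities -/

/-- Lower densities on an increasing sequence of σ-algebras, each extending the previous one,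
have a common extension to the σ-algebra generated by their domains. -/
theorem exists_isLowerDensity_iSup [IsProbabilityMeasure T] (ℱ : Filtration ℕ mZ)
    (d : ℕ → Set Z → Set Z) (hd : ∀ n, IsLowerDensity T (ℱ n) mZ (d n))
    (hext : ∀ n m, n ≤ m → ∀ B, MeasurableSet[ℱ n] B → d m B = d n B) :
    ∃ δ', IsLowerDensity T (⨆ n, ℱ n) mZ δ' ∧
      ∀ n B, MeasurableSet[ℱ n] B → δ' B = d n B := by
  have hle : (⨆ n, (ℱ n : MeasurableSpace Z)) ≤ mZ := iSup_le ℱ.le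
  let g : Set Z → Z → ℝ := fun B => B.indicator fun _ => (1 : ℝ)
  let L : Set Z → ℕ → ℕ → Set Z := fun B k m => {z | 1 - (2 : ℝ)⁻¹ ^ k < (T[g B | ℱ m]) z}
  have hL : ∀ B k m, MeasurableSet[ℱ m] (L B k m) := fun B k m =>
    (stronglyMeasurable_condExp (m := ℱ m)).measurable measurableSet_Ioi
  have hgi : ∀ {B}, MeasurableSet B → Integrable (g B) T := fun hB =>
    (integrable_const _).indicator hB
  let δ' : Set Z → Set Z := fun B => ⋂ k : ℕ, ⋃ n : ℕ, ⋂ m : ℕ, ⋂ _ : n ≤ m, d m (L B k m)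
  have hmem : ∀ B z, z ∈ δ' B ↔ ∀ k, ∃ n, ∀ m, n ≤ m → z ∈ d m (L B k m) := fun B z => by
    simp [δ']
  have hpow : ∀ k : ℕ, 0 < (2 : ℝ)⁻¹ ^ k ∧ (2 : ℝ)⁻¹ ^ k ≤ 1 := fun k =>
    ⟨by positivity, pow_le_one₀ (by norm_num) (by norm_num)⟩
  have hext' : ∀ n B, MeasurableSet[ℱ n] B → δ' B = d n B := by
    intro n B hB
    -- If `B` already belongs to `ℱ n`, its conditional expectation is its own indicator, and `0 ≤ 1
    -- - 2⁻ᵏ < 1` makes every level set equal to `B`, including `k = 0`.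
    have hLB : ∀ k m, n ≤ m → L B k m = B := by
      intro k m hnm
      have hB' : MeasurableSet[ℱ m] B := ℱ.mono hnm _ hB
      have he : T[g B | ℱ m] = g B := condExp_of_stronglyMeasurable (ℱ.le m)
        (stronglyMeasurable_const.indicator hB') (hgi (ℱ.le m _ hB'))
      ext z
      simp only [L, he, g, mem_ofPred_eq]
      by_cases hz : z ∈ B <;> simp [hz]
      simpa using (hpow k).2
    ext z
    rw [hmem]
    constructor
    · intro hz
      obtain ⟨i, hi⟩ := hz 0
      have := hi (max i n) (le_max_left _ _)
      rwa [hLB _ _ (le_max_right _ _), hext n _ (le_max_right _ _) B hB] at this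
    · intro hz k
      refine ⟨n, fun m hm => ?_⟩
      rwa [hLB k m hm, hext n m hm B hB]
  have hmono : ∀ {B C}, MeasurableSet B → MeasurableSet C → (∀ᵐ z ∂T, z ∈ B → z ∈ C) →
      δ' B ⊆ δ' C := by
    intro B C hB hC hBC z hz
    rw [hmem] at hz ⊢
    intro k
    obtain ⟨n, hn⟩ := hz k
    refine ⟨n, fun m hm => (hd m).subset_of_ae (hL B k m) (hL C k m) ?_ (hn m hm)⟩
    have hle : g B ≤ᵐ[T] g C := by
      filter_upwards [hBC] with z hz
      by_cases hzB : z ∈ B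
      · simp [g, hzB, hz hzB]
      · simp only [g, indicator_of_notMem hzB]
        exact indicator_nonneg (fun _ _ => zero_le_one) z
    filter_upwards [condExp_mono (m := ℱ m) (hgi hB) (hgi hC) hle] with z hz hzL
    exact lt_of_lt_of_le hzL hz
  refine ⟨δ', ⟨?_, ?_, ?_, ?_, ?_, ?_⟩, hext'⟩
  · intro B _
    exact MeasurableSet.iInter fun k => MeasurableSet.iUnion fun n => MeasurableSet.iInter fun m =>
      MeasurableSet.iInter fun _ => (hd m).measurable _ (hL B k m)
  · rw [hext' 0 _ (@MeasurableSet.empty Z (ℱ 0)), (hd 0).empty]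
  · rw [hext' 0 _ (@MeasurableSet.univ Z (ℱ 0)), (hd 0).univ]
  · intro B C hB hC
    have hB := hle _ hB
    have hC := hle _ hC
    refine Subset.antisymm (subset_inter ?_ ?_) ?_
    · exact hmono (hB.inter hC) hB (Filter.Eventually.of_forall fun z hz => hz.1)
    · exact hmono (hB.inter hC) hC (Filter.Eventually.of_forall fun z hz => hz.2)
    · rintro z ⟨hzB, hzC⟩
      rw [hmem] at hzB hzC ⊢
      intro k
      -- Passing to `k + 1` halves the error: the indicators satisfy `1_B + 1_C ≤ 1_{B ∩ C} + 1`, so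
      -- two conditional expectations above `1 - 2⁻ᵏ⁻¹` force that of `B ∩ C` above `1 - 2⁻ᵏ`.
      obtain ⟨n₁, h₁⟩ := hzB (k + 1)
      obtain ⟨n₂, h₂⟩ := hzC (k + 1)
      refine ⟨max n₁ n₂, fun m hm => ?_⟩
      have hz : z ∈ d m (L B (k + 1) m ∩ L C (k + 1) m) := by
        rw [(hd m).inter _ _ (hL B _ m) (hL C _ m)]
        exact ⟨h₁ m (le_trans (le_max_left _ _) hm), h₂ m (le_trans (le_max_right _ _) hm)⟩
      refine (hd m).subset_of_ae ((hL B _ m).inter (hL C _ m)) (hL _ k m) ?_ hz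
      have hsum : g B + g C ≤ᵐ[T] g (B ∩ C) + fun _ => (1 : ℝ) := by
        refine Filter.Eventually.of_forall fun z => ?_
        by_cases hzB : z ∈ B <;> by_cases hzC : z ∈ C <;> simp [g, hzB, hzC]
      filter_upwards [condExp_mono (m := ℱ m) ((hgi hB).add (hgi hC))
        ((hgi (hB.inter hC)).add (integrable_const 1)) hsum,
        condExp_add (hgi hB) (hgi hC) (ℱ m),
        condExp_add (hgi (hB.inter hC)) (integrable_const (1 : ℝ)) (ℱ m)] with z h1 h2 h3 hzBC
      have h4 : (T[fun _ => (1 : ℝ) | ℱ m]) z = 1 := by rw [condExp_const (ℱ.le m)]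
      rw [h2, h3] at h1
      simp only [Pi.add_apply, h4] at h1
      obtain ⟨h5, h6⟩ := hzBC
      simp only [L, mem_ofPred_eq, pow_succ] at h5 h6 ⊢
      linarith
  · intro B hB
    rw [measure_symmDiff_eq_zero_iff, Filter.eventuallyEq_set]
    -- By Lévy's upward theorem the conditional expectations of `B` converge almost everywhere to
    -- its indicator. Limit `1` eventually exceeds every threshold; limit `0` already fails the
    -- threshold `1/2`, that is, `k = 1`.
    have hlim : T[g B | ⨆ n, ℱ n] = g B := condExp_of_stronglyMeasurable hle
      (stronglyMeasurable_const.indicator hB) (hgi (hle _ hB))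
    have h1 := tendsto_ae_condExp (μ := T) (ℱ := ℱ) (g B)
    rw [hlim] at h1
    have h2 : ∀ᵐ z ∂T, ∀ k m, z ∈ d m (L B k m) ↔ z ∈ L B k m :=
      ae_all_iff.2 fun k => ae_all_iff.2 fun m => (hd m).ae_mem_iff (hL B k m)
    filter_upwards [h1, h2] with z h1 h2
    rw [hmem]
    simp only [h2]
    by_cases hz : z ∈ B
    · simp only [hz, iff_true]
      intro k
      have h3 : ∀ᶠ m in Filter.atTop, 1 - (2 : ℝ)⁻¹ ^ k < (T[g B | ℱ m]) z :=
        h1.eventually_const_lt (by simp [g, hz])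
      exact Filter.eventually_atTop.1 h3
    · simp only [hz, iff_false]
      intro hk
      obtain ⟨n, hn⟩ := hk 1
      have h3 : ∀ᶠ m in Filter.atTop, (T[g B | ℱ m]) z < 1 - (2 : ℝ)⁻¹ ^ 1 :=
        h1.eventually_lt_const (by simp [g, hz]; norm_num)
      obtain ⟨n', hn'⟩ := Filter.eventually_atTop.1 h3
      exact lt_asymm (hn _ (le_max_left n n')) (hn' _ (le_max_right n n'))
  · intro B C hB hC hBC
    have hB := hle _ hB
    have hC := hle _ hC
    have hBC := Filter.eventuallyEq_set.1 (measure_symmDiff_eq_zero_iff.1 hBC)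
    exact Subset.antisymm (hmono hB hC (hBC.mono fun z hz => hz.1))
      (hmono hC hB (hBC.mono fun z hz => hz.2))

/-! ### Zorn's lemma for partial densities -/

variable {Z : Type*} {mZ : MeasurableSpace Z} {T : Measure Z}

variable (T) in
/-- A lower density on a sub-σ-algebra of the domain of `T`. -/
structure PartialLowerDensity where
  dom : MeasurableSpace Z
  toFun : Set Z → Set Z
  dom_le : dom ≤ mZ
  isLowerDensity : IsLowerDensity T dom mZ toFun

/-- `q` extends `p`. -/
def PartialLowerDensity.Extends (p q : PartialLowerDensity T) : Prop :=
  p.dom ≤ q.dom ∧ ∀ B, MeasurableSet[p.dom] B → q.toFun B = p.toFun B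

theorem PartialLowerDensity.Extends.refl (p : PartialLowerDensity T) : p.Extends p :=
  ⟨le_rfl, fun _ _ => rfl⟩

theorem PartialLowerDensity.Extends.trans {p q r : PartialLowerDensity T} (h : p.Extends q)
    (h' : q.Extends r) : p.Extends r :=
  ⟨h.1.trans h'.1, fun B hB => (h'.2 B (h.1 B hB)).trans (h.2 B hB)⟩

/-- On the trivial σ-algebra the identity is a density: since `T` has total mass one, `∅` and the
whole space are not equivalent. This supplies the starting point for Zorn's lemma. -/
theorem PartialLowerDensity.exists_bot [IsProbabilityMeasure T] :
    Nonempty (PartialLowerDensity T) := by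
  refine ⟨⟨⊥, id, bot_le, ⟨fun B hB => bot_le (a := mZ) B hB, rfl, rfl, fun _ _ _ _ => rfl,
    fun B _ => by simp, ?_⟩⟩⟩
  intro B C hB hC hBC
  rcases MeasurableSpace.measurableSet_bot_iff.1 hB with rfl | rfl <;>
  rcases MeasurableSpace.measurableSet_bot_iff.1 hC with rfl | rfl <;> simp at hBC ⊢

theorem PartialLowerDensity.exists_extends_seq [IsProbabilityMeasure T]
    (p : ℕ → PartialLowerDensity T) (hp : ∀ n, (p n).Extends (p (n + 1))) :
    ∃ q, ∀ n, (p n).Extends q := by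
  have hle : ∀ n m, n ≤ m → (p n).Extends (p m) := by
    intro n m hnm
    induction m, hnm using Nat.le_induction with
    | base => exact .refl _
    | succ m _ ih => exact ih.trans (hp m)
  let ℱ : Filtration ℕ mZ := ⟨fun n => (p n).dom, fun n m h => (hle n m h).1,
    fun n => (p n).dom_le⟩
  obtain ⟨δ', hδ', hext⟩ := exists_isLowerDensity_iSup ℱ (fun n => (p n).toFun)
    (fun n => (p n).isLowerDensity) fun n m h => (hle n m h).2
  exact ⟨⟨⨆ n, ℱ n, δ', iSup_le ℱ.le, hδ'⟩, fun n => ⟨le_iSup (fun n => ℱ n) n, hext n⟩⟩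

/-- A family of partial lower densities in which every sequence is bounded has an upper bound. -/
theorem PartialLowerDensity.exists_extends_of_countably_directed
    {c : Set (PartialLowerDensity T)} (hne : c.Nonempty)
    (hc : ∀ p : ℕ → c, ∃ q ∈ c, ∀ n, (p n).1.Extends q) : ∃ q, ∀ p ∈ c, p.Extends q := by
  classical
  have hc₂ : ∀ p ∈ c, ∀ p' ∈ c, ∃ q ∈ c, p.Extends q ∧ p'.Extends q := by
    intro p hp p' hp'
    obtain ⟨q, hq, h⟩ := hc fun n => if n = 0 then ⟨p, hp⟩ else ⟨p', hp'⟩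
    exact ⟨q, hq, by simpa using h 0, by simpa using h 1⟩
  let D : MeasurableSpace Z :=
    { MeasurableSet' := fun B => ∃ p ∈ c, MeasurableSet[p.dom] B
      measurableSet_empty := ⟨hne.some, hne.some_mem, @MeasurableSet.empty Z hne.some.dom⟩
      measurableSet_compl := fun B ⟨p, hp, hB⟩ => ⟨p, hp, hB.compl⟩
      measurableSet_iUnion := fun f hf => by
        choose p hp hf using hf
        obtain ⟨q, hq, h⟩ := hc fun n => ⟨p n, hp n⟩
        exact ⟨q, hq, MeasurableSet.iUnion fun i => (h i).1 _ (hf i)⟩ }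
  let δ' : Set Z → Set Z := fun B => {z | ∃ p ∈ c, MeasurableSet[p.dom] B ∧ z ∈ p.toFun B}
  have hδ' : ∀ p ∈ c, ∀ B, MeasurableSet[p.dom] B → δ' B = p.toFun B := by
    intro p hp B hB
    ext z
    refine ⟨?_, fun hz => ⟨p, hp, hB, hz⟩⟩
    rintro ⟨p', hp', hB', hz⟩
    obtain ⟨q, _, h, h'⟩ := hc₂ p hp p' hp'
    rwa [← h.2 B hB, h'.2 B hB']
  have hD : D ≤ mZ := fun B ⟨p, _, hB⟩ => p.dom_le B hB
  have hcommon : ∀ B C, MeasurableSet[D] B → MeasurableSet[D] C →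
      ∃ q ∈ c, MeasurableSet[q.dom] B ∧ MeasurableSet[q.dom] C := by
    rintro B C ⟨p, hp, hB⟩ ⟨p', hp', hC⟩
    obtain ⟨q, hq, h, h'⟩ := hc₂ p hp p' hp'
    exact ⟨q, hq, h.1 B hB, h'.1 C hC⟩
  refine ⟨⟨D, δ', hD, ?_, ?_, ?_, ?_, ?_, ?_⟩, fun p hp => ⟨fun B hB => ⟨p, hp, hB⟩, hδ' p hp⟩⟩
  · rintro B ⟨p, hp, hB⟩
    rw [hδ' p hp B hB]
    exact p.isLowerDensity.measurable B hB
  · rw [hδ' _ hne.some_mem _ (@MeasurableSet.empty Z hne.some.dom), hne.some.isLowerDensity.empty]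
  · rw [hδ' _ hne.some_mem _ (@MeasurableSet.univ Z hne.some.dom), hne.some.isLowerDensity.univ]
  · intro B C hB hC
    obtain ⟨q, hq, hB, hC⟩ := hcommon B C hB hC
    rw [hδ' q hq _ (hB.inter hC), hδ' q hq _ hB, hδ' q hq _ hC, q.isLowerDensity.inter B C hB hC]
  · rintro B ⟨p, hp, hB⟩
    rw [hδ' p hp B hB]
    exact p.isLowerDensity.equiv B hB
  · intro B C hB hC hBC
    obtain ⟨q, hq, hB, hC⟩ := hcommon B C hB hC
    rw [hδ' q hq _ hB, hδ' q hq _ hC, q.isLowerDensity.congr B C hB hC hBC]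

/-- A dichotomy on cofinality. If every sequence in the chain has an upper bound in it, the union of
the domains is already a σ-algebra. Otherwise some sequence is cofinal, and the martingale limit
along it bounds the chain. -/
theorem PartialLowerDensity.exists_extends_of_isChain [IsProbabilityMeasure T]
    {c : Set (PartialLowerDensity T)} (hne : c.Nonempty)
    (hc : IsChain PartialLowerDensity.Extends c) : ∃ q, ∀ p ∈ c, p.Extends q := by
  by_cases hcof : ∀ p : ℕ → c, ∃ q ∈ c, ∀ n, (p n).1.Extends q
  · exact exists_extends_of_countably_directed hne hcof
  push Not at hcof
  obtain ⟨p, hp⟩ := hcof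
  have htot : ∀ a ∈ c, ∀ b ∈ c, a.Extends b ∨ b.Extends a := by
    intro a ha b hb
    by_cases hab : a = b
    · exact Or.inl (hab ▸ .refl a)
    · exact hc ha hb hab
  -- The cofinal sequence need not be increasing; directedness yields an increasing one that
  -- dominates each of its terms.
  have hdir : Directed PartialLowerDensity.Extends fun n => (p n).1 := by
    intro i j
    rcases htot _ (p i).2 _ (p j).2 with h | h
    · exact ⟨j, h, .refl _⟩
    · exact ⟨i, .refl _, h⟩
  obtain ⟨q, hq⟩ := exists_extends_seq (fun n => (p (hdir.sequence _ n)).1)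
    hdir.sequence_mono_nat
  refine ⟨q, fun a ha => ?_⟩
  obtain ⟨n, hn⟩ := hp a ha
  exact ((htot _ (p n).2 a ha).resolve_left hn).trans ((hdir.rel_sequence n).trans (hq _))

/-- Every probability space, complete or not, has a lower density with measurable values. -/
theorem exists_isLowerDensity {mZ : MeasurableSpace Z} (T : Measure Z) [IsProbabilityMeasure T] :
    ∃ δ, IsLowerDensity T mZ mZ δ := by
  have := PartialLowerDensity.exists_bot (T := T)
  obtain ⟨p, hp⟩ := exists_maximal_of_nonempty_chains_bounded
    (r := PartialLowerDensity.Extends (T := T))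
    (fun c hc hne => PartialLowerDensity.exists_extends_of_isChain hne hc)
    fun h h' => h.trans h'
  -- A measurable `M` outside the maximal domain could be adjoined, so maximality puts it inside.
  have hdom : mZ ≤ p.dom := by
    intro M hM
    obtain ⟨δ', hδ', hext⟩ := p.isLowerDensity.exists_adjoinSet p.dom_le hM
    have hle : adjoinSet p.dom M ≤ mZ := by
      rintro B ⟨G, H, hG, hH, rfl⟩
      exact hM.ite (p.dom_le _ hG) (p.dom_le _ hH)
    refine (hp ⟨adjoinSet p.dom M, δ', hle, hδ'⟩
      ⟨fun B hB => ⟨B, B, hB, hB, (Set.ite_same M B).symm⟩, hext⟩).1 M ?_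
    exact ⟨univ, ∅, @MeasurableSet.univ Z p.dom, @MeasurableSet.empty Z p.dom, by simp [Set.ite]⟩
  have h := p.isLowerDensity
  rw [le_antisymm p.dom_le hdom] at h
  exact ⟨_, h⟩

end LowerDensity


/-! ### Densities on skew products -/

/-! ### Approximation by `mC`-measurable sets -/

/-- If `μ` is inner regular with respect to a σ-algebra, every measurable set agrees with a
member of that σ-algebra up to a null set. -/
theorem ApproximatedBy.exists_ae_eq {X : Type*} {mC m : MeasurableSpace X} {μ : Measure X}
    (h : ApproximatedBy μ {K | MeasurableSet[mC] K}) {E : Set X} (hE : MeasurableSet E) :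
    ∃ C, MeasurableSet[mC] C ∧ E =ᵐ[μ] C := by
  have hpos : ∀ n : ℕ, (0 : ℝ≥0∞) < (n + 1 : ℝ≥0∞)⁻¹ := fun n => by simp
  choose K hK hKE hμ using fun n : ℕ => h E hE _ (hpos n)
  refine ⟨⋃ n, K n, MeasurableSet.iUnion hK, ?_⟩
  rw [← measure_symmDiff_eq_zero_iff, symmDiff_of_ge (iUnion_subset hKE)]
  have hlim : Filter.Tendsto (fun n : ℕ => (n + 1 : ℝ≥0∞)⁻¹) Filter.atTop (nhds 0) := by
    have := ENNReal.tendsto_inv_nat_nhds_zero.comp (Filter.tendsto_add_atTop_nat 1)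
    simpa [Function.comp_def] using this
  exact le_antisymm (ge_of_tendsto' hlim fun n =>
    (measure_mono (sdiff_subset_sdiff_right (subset_iUnion K n))).trans (hμ n).le) bot_le

/-- Inner regularity of a marginal with respect to `mC` makes every product measurable set
agree with a set of `mC ⊗ 𝔅` up to a null set. -/
theorem IsSkewProduct.exists_ae_eq {X Y : Type*} (mC : MeasurableSpace X)
    [mX : MeasurableSpace X] [mY : MeasurableSpace Y] {P : Measure X} {Q : Measure Y}
    {R : Measure (X × Y)} (hR : IsSkewProduct P Q R)
    (hP : ApproximatedBy P {K | MeasurableSet[mC] K}) {W : Set (X × Y)} (hW : MeasurableSet W) :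
    ∃ W', MeasurableSet[mC.prod mY] W' ∧ W =ᵐ[R] W' := by
  -- The sets that agree almost everywhere with a member of `mC ⊗ 𝔅` form a σ-algebra, so cylinders
  -- suffice. For those over `X`, null sets of `P` pull back to null sets of `R` because `P` is its
  -- marginal.
  have hle : mX.prod mY ≤ eventuallyMeasurableSpace (mC.prod mY) (ae R) := by
    refine sup_le ?_ ?_
    · rintro _ ⟨E, hE, rfl⟩
      obtain ⟨C, hC, hEC⟩ := hP.exists_ae_eq hE
      refine ⟨Prod.fst ⁻¹' C, le_sup_left (b := mY.comap Prod.snd) _ ⟨C, hC, rfl⟩, ?_⟩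
      rw [← hR.fst] at hEC
      exact ae_eq_comp (f := Prod.fst) (g := (· ∈ E)) (g' := (· ∈ C))
        measurable_fst.aemeasurable hEC
    · rintro _ ⟨B, hB, rfl⟩
      exact ⟨_, le_sup_right (a := mC.comap Prod.fst) _ ⟨B, hB, rfl⟩, Filter.EventuallyEq.rfl⟩
  exact hle W hW

theorem IsNil.union {X Y : Type*} [mY : MeasurableSpace Y] {Q : Measure Y}
    {A : Y → MeasurableSpace X} {S : ∀ y, Measure[A y] X} {E F : Set (X × Y)}
    (hE : IsNil Q A S E) (hF : IsNil Q A S F) :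
    IsNil Q A S (E ∪ F) := by
  filter_upwards [hE, hF] with y h1 h2
  exact measure_union_null h1 h2

/-! ### Null sets of `R` versus nil sets -/

section NilSets

variable {X Y : Type*} [mX : MeasurableSpace X] [mY : MeasurableSpace Y]
  {Q : Measure Y} [IsProbabilityMeasure Q] {R : Measure (X × Y)}
  {A : Y → MeasurableSpace X} {S : ∀ y, Measure[A y] X}

/-- The sections of a null set are almost all null. -/
theorem IsDisintegration.isNil (h : IsDisintegration Q R A S) {V : Set (X × Y)} (hV : R V = 0) :
    IsNil Q A S V := by
  -- The set `V` is arbitrary, so the disintegration formula is applied to a measurable superset of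
  -- the same measure.
  have hm := measurableSet_toMeasurable R V
  obtain ⟨-, h2, h3⟩ := h.section_prod hm
  rw [measure_toMeasurable, hV, lintegral_eq_zero_iff' h2] at h3
  exact IsNil.mono (F := toMeasurable R V) h3 (subset_toMeasurable R V)

theorem IsDisintegration.skewMeasure_eq_zero (h : IsDisintegration Q R A S) {V : Set (X × Y)}
    (hV : IsNil Q A S V) : skewMeasure h V = 0 := by
  have := skewMeasure_symmDiff h (MeasurableSet.empty (α := X × Y)) hV
  rwa [measure_empty, ← bot_eq_empty, bot_symmDiff] at this

/-- Product measurable sets with nil difference agree `R`-almost everywhere. -/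
theorem IsDisintegration.measure_eq_zero (h : IsDisintegration Q R A S) {V : Set (X × Y)}
    (hm : MeasurableSet V) (hV : IsNil Q A S V) : R V = 0 := by
  rw [← (h.section_prod hm).2.2, lintegral_congr_ae hV, lintegral_zero]

/-- Sets of `𝔄 ⋉ 𝔅` which are null for the extension of `R` are nil. -/
theorem IsDisintegration.isNil_of_skewMeasure_eq_zero (h : IsDisintegration Q R A S)
    {V : Set (X × Y)} (hV : MeasurableSet[skewAlgebra Q A S] V) (h0 : skewMeasure h V = 0) :
    IsNil Q A S V := by
  obtain ⟨W, N, hW, hN, rfl⟩ := hV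
  rw [skewMeasure_symmDiff h hW hN] at h0
  refine ((h.isNil h0).union hN).mono fun z hz => ?_
  simp only [mem_symmDiff, mem_union] at hz ⊢
  tauto

end NilSets

/-- A set of `𝔄 ⋉ 𝔅` agrees with a set of `mC ⊗ 𝔅` up to a nil set. -/
theorem IsDisintegration.exists_isNil_symmDiff {X Y : Type*} (mC : MeasurableSpace X)
    [mX : MeasurableSpace X] [mY : MeasurableSpace Y] {Q : Measure Y} [IsProbabilityMeasure Q]
    {R : Measure (X × Y)} {A : Y → MeasurableSpace X} {S : ∀ y, Measure[A y] X}
    (h : IsDisintegration Q R A S) {P : Measure X}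
    (hR : IsSkewProduct P Q R) (hP : ApproximatedBy P {K | MeasurableSet[mC] K}) {F : Set (X × Y)}
    (hF : MeasurableSet[skewAlgebra Q A S] F) :
    ∃ W, MeasurableSet[mC.prod mY] W ∧ IsNil Q A S (F ∆ W) := by
  obtain ⟨W, N, hW, hN, rfl⟩ := hF
  obtain ⟨W', hW', hWW'⟩ := hR.exists_ae_eq mC hP hW
  refine ⟨W', hW', (hN.union (h.isNil (measure_symmDiff_eq_zero_iff.2 hWW'))).mono ?_⟩
  intro z hz
  simp only [mem_symmDiff, mem_union] at hz ⊢
  tauto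

/-- Any admissible `C` is equivalent to `E` within `mC`, where the trimmed measure agrees with `μ`,
so `τ C = τ E`. -/
theorem densityExtension_of_measurableSet {X : Type*} {mC m : MeasurableSpace X} {μ : Measure X}
    (hm : mC ≤ m) {τ : Set X → Set X} (h : IsLowerDensity (μ.trim hm) mC mC τ) {E : Set X}
    (hE : MeasurableSet[mC] E) : densityExtension μ mC τ E = τ E := by
  ext x
  constructor
  · rintro ⟨C, hC, hEC, hx⟩
    rwa [h.congr E C hE hC ((trim_measurableSet_eq hm (hE.symmDiff hC)).trans hEC)]
  · exact fun hx => ⟨E, hE, by simp, hx⟩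

/-! ### Construction of the density on the skew product -/

theorem propositionT2 {X : Type u} {Y : Type v} (mC : MeasurableSpace X)
    [mX : MeasurableSpace X] [mY : MeasurableSpace Y]
    (P : Measure X) [IsProbabilityMeasure P] (Q : Measure Y) [IsProbabilityMeasure Q]
    (R : Measure (X × Y)) (hR : IsSkewProduct P Q R)
    (A : Y → MeasurableSpace X) (S : ∀ y, Measure[A y] X) (hS : IsDisintegration Q R A S)
    (hC : ∀ y, mC ≤ A y)
    (hP : ApproximatedBy P {K | MeasurableSet[mC] K})
    (hSy : ∀ y, ApproximatedBy (S y) {K | MeasurableSet[mC] K})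
    (κ : Ordinal.{w}) (M : Ordinal.{w} → Set X) (τ : Y → Set X → Set X)
    (hτ : IsEquiAdmissible mC A S hC κ M τ) :
    ∃ φ : Set (X × Y) → Set (X × Y),
      IsLowerDensity (skewMeasure hS) (skewAlgebra Q A S) (strictSkewAlgebra mC Q A S hC) φ ∧
      ∀ F, MeasurableSet[skewAlgebra Q A S] F → ∀ y,
        ySection (φ F) y = densityExtension (S y) mC (τ y) (ySection (φ F) y) := by
  classical
  obtain ⟨s, hs⟩ := hτ
  have hd : ∀ y, IsLowerDensity ((S y).trim (hC y)) mC mC (τ y) := fun y => (hs y).density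
  obtain ⟨y₀⟩ : Nonempty Y := nonempty_of_isProbabilityMeasure Q
  -- The inclusion of `mC` in the σ-algebra of `X` passes through `A y₀`, hence the need for a point
  -- of `Y`.
  have hle : mC.prod mY ≤ mX.prod mY :=
    sup_le_sup_right (MeasurableSpace.comap_mono ((hC y₀).trans (hS.le y₀))) _
  have hRp : IsProbabilityMeasure R := ⟨by
    have := hS.prob
    simpa using (hS.dis2 univ univ MeasurableSet.univ MeasurableSet.univ).symm⟩
  have hTp : @IsProbabilityMeasure (X × Y) (mC.prod mY) (R.trim hle) :=
    ⟨by rw [trim_measurableSet_eq hle (@MeasurableSet.univ _ (mC.prod mY)), measure_univ]⟩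
  obtain ⟨δ, hδ⟩ := @exists_isLowerDensity (X × Y) (mC.prod mY) (R.trim hle) hTp
  have hδ_nil : ∀ {W}, MeasurableSet[mC.prod mY] W → IsNil Q A S (δ W ∆ W) := fun {W} hW =>
    hS.isNil ((trim_measurableSet_eq hle ((hδ.measurable W hW).symmDiff hW)).symm.trans
      (hδ.equiv W hW))
  -- For sets of `mC ⊗ 𝔅`, being nil and being `R`-null coincide, so `δ` does not see nil changes.
  have hδ_congr : ∀ {W W'}, MeasurableSet[mC.prod mY] W → MeasurableSet[mC.prod mY] W' →
      IsNil Q A S (W ∆ W') → δ W = δ W' := fun {W W'} hW hW' h =>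
    hδ.congr W W' hW hW' ((trim_measurableSet_eq hle (hW.symmDiff hW')).trans
      (hS.measure_eq_zero (hle _ (hW.symmDiff hW')) h))
  choose! v hv hv_nil using fun F (hF : MeasurableSet[skewAlgebra Q A S] F) =>
    hS.exists_isNil_symmDiff mC hR hP hF
  let φ : Set (X × Y) → Set (X × Y) := fun F => {z | z.1 ∈ τ z.2 (ySection (δ (v F)) z.2)}
  have hφ : ∀ F y, ySection (φ F) y = τ y (ySection (δ (v F)) y) := fun F y => rfl
  have hsec : ∀ {W}, MeasurableSet[mC.prod mY] W → ∀ y, MeasurableSet[mC] (ySection W y) :=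
    fun hW y => (@measurable_prodMk_right X Y mC mY y) hW
  have hδsec : ∀ {F}, MeasurableSet[skewAlgebra Q A S] F → ∀ y,
      MeasurableSet[mC] (ySection (δ (v F)) y) := fun hF y => hsec (hδ.measurable _ (hv _ hF)) y
  have hτ_null : ∀ {E} y, MeasurableSet[mC] E → S y (τ y E ∆ E) = 0 := fun {E} y hE =>
    (trim_measurableSet_eq (hC y) (((hd y).measurable E hE).symmDiff hE)).symm.trans
      ((hd y).equiv E hE)
  -- Two errors add up: `δ` changes almost every section of `v F` by a null set, and `τ y` changes
  -- every section by a null set.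
  have hφv : ∀ {F}, MeasurableSet[skewAlgebra Q A S] F → IsNil Q A S (φ F ∆ v F) := by
    intro F hF
    filter_upwards [hδ_nil (hv F hF)] with y hy
    refine measure_mono_null (t := (τ y (ySection (δ (v F)) y) ∆ ySection (δ (v F)) y) ∪
      ySection (δ (v F) ∆ v F) y) ?_ (measure_union_null (hτ_null y (hδsec hF y)) hy)
    exact symmDiff_triangle _ _ _
  have hδv : ∀ {F W}, MeasurableSet[skewAlgebra Q A S] F → MeasurableSet[mC.prod mY] W →
      IsNil Q A S (F ∆ W) → δ (v F) = δ W := by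
    intro F W hF hW hFW
    refine hδ_congr (hv F hF) hW (((hv_nil F hF).union hFW).mono ?_)
    rw [symmDiff_comm F (v F)]
    exact symmDiff_triangle _ _ _
  refine ⟨φ, ⟨?_, ?_, ?_, ?_, ?_, ?_⟩, ?_⟩
  · intro F hF
    -- All sections of `v F` and of `φ F` lie in `mC`, so the correction term is strictly nil and
    -- not merely nil.
    refine ⟨v F, v F ∆ φ F, hv F hF, ⟨fun y => ?_, ?_⟩,
      (symmDiff_symmDiff_cancel_left _ _).symm⟩
    · exact hC y _ ((hsec (hv F hF) y).symmDiff ((hd y).measurable _ (hδsec hF y)))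
    · rw [symmDiff_comm]
      exact hφv hF
  · have h : δ (v ∅) = ∅ := by
      rw [hδv (@MeasurableSet.empty _ (skewAlgebra Q A S)) (@MeasurableSet.empty _ (mC.prod mY)),
        hδ.empty]
      rw [symmDiff_self]
      exact Filter.Eventually.of_forall fun y => measure_empty
    ext ⟨x, y⟩
    change x ∈ τ y (ySection (δ (v ∅)) y) ↔ _
    rw [h, show ySection (∅ : Set (X × Y)) y = ∅ from rfl, (hd y).empty]
    simp
  · have h : δ (v univ) = univ := by
      rw [hδv (@MeasurableSet.univ _ (skewAlgebra Q A S)) (@MeasurableSet.univ _ (mC.prod mY)),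
        hδ.univ]
      rw [symmDiff_self]
      exact Filter.Eventually.of_forall fun y => measure_empty
    ext ⟨x, y⟩
    change x ∈ τ y (ySection (δ (v univ)) y) ↔ _
    rw [h, show ySection (univ : Set (X × Y)) y = univ from rfl, (hd y).univ]
    simp
  · intro B C hB hC'
    have h : δ (v (B ∩ C)) = δ (v B) ∩ δ (v C) := by
      rw [← hδ.inter _ _ (hv B hB) (hv C hC')]
      refine hδv (MeasurableSet.inter hB hC') ((hv B hB).inter (hv C hC'))
        (((hv_nil B hB).union (hv_nil C hC')).mono fun z hz => ?_)
      simp only [mem_symmDiff, mem_union, mem_inter_iff] at hz ⊢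
      tauto
    ext ⟨x, y⟩
    change x ∈ τ y (ySection (δ (v (B ∩ C))) y) ↔
      x ∈ τ y (ySection (δ (v B)) y) ∩ τ y (ySection (δ (v C)) y)
    rw [h, ← (hd y).inter _ _ (hδsec hB y) (hδsec hC' y)]
    rfl
  · intro B hB
    refine hS.skewMeasure_eq_zero (((hφv hB).union (hv_nil B hB)).mono ?_)
    rw [symmDiff_comm B]
    exact symmDiff_triangle _ _ _
  · intro B C hB hC' hBC
    have h : δ (v B) = δ (v C) := by
      refine hδv hB (hv C hC') (((hS.isNil_of_skewMeasure_eq_zero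
        (MeasurableSet.symmDiff hB hC') hBC).union (hv_nil C hC')).mono ?_)
      exact symmDiff_triangle _ _ _
    simp only [φ, h]
  · intro F hF y
    have hm := hδsec hF y
    -- The section is of the form `τ y E` with `E` in `mC`; as `τ y E` is equivalent to `E`,
    -- applying `τ y` again changes nothing.
    rw [hφ, densityExtension_of_measurableSet (hC y) (hd y) ((hd y).measurable _ hm)]
    exact ((hd y).congr _ _ ((hd y).measurable _ hm) hm ((hd y).equiv _ hm)).symm
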